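/- Let $X$ be a lattice in a finite-dimensional real vector space $X_{\mathbf R}$, let $Q\subset X_{\mathbf R}$ be a lattice polytope, and put $I=Q\cap X$. Assume that $Q$ contains a full-dimensional regular simplex $\sigma$, i.e. a simplex with vertices $v_0,\dots,v_g\in I$ such that $(v_0,1),\dots,(v_g,1)$ is a $\mathbf Z$-basis of $X\times\mathbf Z$; fix one. Let $Aff\subset\mathbf R^I$ be the space of restrictions to $I$ of affine functions, $\mathbb L^*_{\mathbf R}=\mathbf R^I/Aff$, and let $\mathbb L_{\mathbf R}$ be the dual space of $\mathbb L^*_{\mathbf R}$. For $\psi\in\mathbf R^I$ let $L_\sigma(\psi)$ be the affine function that agrees with $\psi$ at the vertices of $\sigma$, and let $\Psi:I\to\mathbb L_{\mathbf R}$ be given by $\langle\bar\psi,\Psi(\omega)\rangle=\psi(\omega)-L_\sigma(\psi)(\omega)$. A triangulation $\mathscr T$ of $Q$ with vertices in $I$ is coherent if its maximal simplices are the domains of affinity of a convex piecewise affine function on $Q$. For a function $\psi$ on $I$ with values in a real vector space, let $g_{\psi,\mathscr T}$ be the function on $Q$ that equals $\psi$ at the vertices of $\mathscr T$ and is affine on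 each simplex of $\mathscr T$. Let $I_\emptyset$ be the set of points of $I$ that are not vertices of $\mathscr T$. The secondary cone $C(\mathscr T)\subset\mathbb L^*_{\mathbf R}$ is the image of the cone of all $\psi\in\mathbf R^I$ such that $g_{\psi,\mathscr T}$ is convex and $g_{\psi,\mathscr T}(\omega)\le\psi(\omega)$ for all $\omega\in I_\emptyset$. Let $\mathbb L_{\mathscr T}\subset\mathbb L_{\mathbf R}$ be the group of all functionals with integral values on the classes of those $\psi$ for which $g_{\psi,\mathscr T}$ is, on each maximal simplex, the restriction of an affine function with integral values on $X$, and $\psi(\omega)-g_{\psi,\mathscr T}(\omega)\in\mathbf Z$ for all $\omega\in I_\emptyset$. Put $S_{C(\mathscr T)}=C(\mathscr T)^\vee\cap\mathbb L_{\mathscr T}$. Let $\mathscr T_1,\mathscr T_2$ be coherent triangulations of $Q$ with vertices in $I$ such that $C(\mathscr T_1)$ and $C(\mathscr T_2)$ are of maximal dimension, and let $\tau=C(\mathscr T_1)\cap C(\mathscr T_2)$. Let $\mathbb L_\tau$ be the group generated by $S_{C(\mathscr T_1)}$ and $S_{C(\mathscr T_2)}$, let $S_\tau=(C(\mathscr T_1)^\vee+C(\mathscr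 T_2)^\vee)\cap\mathbb L_\tau$, and let $S_\tau^*$ be the group of invertible elements of $S_\tau$. Then $\tau$ is a common face of $C(\mathscr T_1)$ and $C(\mathscr T_2)$, $\tau^\vee=C(\mathscr T_1)^\vee+C(\mathscr T_2)^\vee$, and the function $g^{12}=g_{\Psi,\mathscr T_1}-g_{\Psi,\mathscr T_2}:Q\to\mathbb L_{\mathbf R}$ takes values in the units of the monoid of $\tau$ in the following sense: $g^{12}(x)\in(S_\tau^*)_{\mathbf Q}$ for every rational point $x$ of $Q$ (a point with $nx\in X$ for some integer $n\ge 1$), and $g^{12}(x)\in(S_\tau^*)_{\mathbf R}$ for every $x\in Q$. Here $(S_\tau^*)_{\mathbf Q}$ and $(S_\tau^*)_{\mathbf R}$ denote the $\mathbf Q$-span and the $\mathbf R$-span of $S_\tau^*$ in $\mathbb L_{\mathbf R}$. -/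

import Mathlib

noncomputable section

namespace SecondaryFan

open Geometry

variable {E : Type*} [AddCommGroup E] [Module ℝ E]

/-- `I = Q(ℤ)`: the set of lattice points of `Q`. After the choice of an origin, the lattice is a
subgroup `X` of the ambient real vector space `E = X_ℝ`. -/
abbrev LatticePoints (X : Submodule ℤ E) (Q : Set E) : Type _ := {ω : E // ω ∈ Q ∧ ω ∈ X}

/-- `Q` is a lattice polytope. -/
def IsLatticePolytope (X : Submodule ℤ E) (Q : Set E) : Prop :=
  ∃ s : Finset E, (∀ v ∈ s, v ∈ X) ∧ Q = convexHull ℝ (s : Set E)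

/-- `x` is a rational point: `n x` is a lattice point for some `n ≥ 1`. -/
def IsRationalPoint (X : Submodule ℤ E) (x : E) : Prop :=
  ∃ n : ℕ, 0 < n ∧ n • x ∈ X

/-- `a` is an integral affine function: it takes integral values on the lattice. -/
def IsIntegralAffine (X : Submodule ℤ E) (a : E →ᵃ[ℝ] ℝ) : Prop :=
  ∀ x ∈ X, ∃ n : ℤ, a x = n

/-! ### Triangulations -/

/-- The simplicial complex `T` is an integral triangulation of `Q`. -/
structure IsTriangulation (X : Submodule ℤ E) (Q : Set E) (T : SimplicialComplex ℝ E) :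
    Prop where
  space_eq : T.space = Q
  vertices_subset : ∀ v ∈ T.vertices, v ∈ X

/-- `T` is coherent (regular): its maximal simplices are the domains of affinity of some convex
piecewise affine function on `Q`. -/
def IsCoherent (Q : Set E) (T : SimplicialComplex ℝ E) : Prop :=
  ∃ φ : E → ℝ, ConvexOn ℝ Q φ ∧
    (∀ s ∈ T.facets, ∃ a : E →ᵃ[ℝ] ℝ, Set.EqOn φ a (convexHull ℝ (s : Set E))) ∧
    ∀ s ∈ T.facets, ∀ t ∈ T.facets, s ≠ t →
      ¬ ∃ a : E →ᵃ[ℝ] ℝ,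
        Set.EqOn φ a (convexHull ℝ (s : Set E) ∪ convexHull ℝ (t : Set E))

/-- `w` is the family of barycentric coordinates of `x` with respect to the vertices of a simplex
of `T` that contains `x`. -/
def IsBarycentric {X : Submodule ℤ E} {Q : Set E} (T : SimplicialComplex ℝ E) (x : E)
    (w : LatticePoints X Q →₀ ℝ) : Prop :=
  (∃ s ∈ T.faces, ∀ ω ∈ w.support, (ω : E) ∈ s) ∧ (∀ ω, 0 ≤ w ω) ∧
    (w.sum fun _ c => c) = 1 ∧ (w.sum fun ω c => c • (ω : E)) = x

open Classical in
/-- The barycentric coordinates of a point of `Q` with respect to `T` (zero outside the support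
of `T`). -/
def baryCoords (X : Submodule ℤ E) (Q : Set E) (T : SimplicialComplex ℝ E) (x : E) :
    LatticePoints X Q →₀ ℝ :=
  if h : ∃ w : LatticePoints X Q →₀ ℝ, IsBarycentric T x w then h.choose else 0

/-- `g_{ψ,T}`: the function on `Q` that is equal to `ψ` at the vertices of `T` and affinely
interpolates `ψ` inside each simplex of `T`. The values of `ψ` lie in any real vector space. -/
def interp {X : Submodule ℤ E} {Q : Set E} {M : Type*} [AddCommGroup M] [Module ℝ M]
    (T : SimplicialComplex ℝ E) (ψ : LatticePoints X Q → M) (x : E) : M :=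
  (baryCoords X Q T x).sum fun ω c => c • ψ ω

section interp

variable {X : Submodule ℤ E} {Q : Set E} {M : Type*} [AddCommGroup M] [Module ℝ M]
  (T : SimplicialComplex ℝ E)

theorem interp_zero : interp T (0 : LatticePoints X Q → M) = 0 := by
  funext x; simp [interp]

theorem interp_add (ψ χ : LatticePoints X Q → M) :
    interp T (ψ + χ) = interp T ψ + interp T χ := by
  funext x; simp [interp, Finsupp.sum_add]

theorem interp_smul (r : ℝ) (ψ : LatticePoints X Q → M) :
    interp T (r • ψ) = r • interp T ψ := by
  funext x; simp [interp, Finsupp.smul_sum, smul_comm r]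

end interp

/-! ### The secondary fan -/

section fan

variable (X : Submodule ℤ E) (Q : Set E)

/-- `Aff ⊆ ℝ^I`: the restrictions to `I` of affine functions. -/
def affSubspace : Submodule ℝ (LatticePoints X Q → ℝ) where
  carrier := {ψ | ∃ a : E →ᵃ[ℝ] ℝ, ∀ ω, ψ ω = a ω}
  zero_mem' := ⟨0, by simp⟩
  add_mem' := by
    rintro _ _ ⟨a, ha⟩ ⟨b, hb⟩
    exact ⟨a + b, fun ω => by simp [ha, hb]⟩
  smul_mem' := by
    rintro r _ ⟨a, ha⟩
    exact ⟨r • a, fun ω => by simp [ha]⟩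

/-- `𝕃*_ℝ = ℝ^I / Aff`, the space that contains the secondary fan. -/
abbrev LStar : Type _ := (LatticePoints X Q → ℝ) ⧸ affSubspace X Q

/-- `𝕃_ℝ = Aff^⊥`, the dual space of `𝕃*_ℝ`. -/
abbrev LSpace : Type _ := Module.Dual ℝ (LStar X Q)

variable (T : SimplicialComplex ℝ E)

/-- The cone `C̃(T)` of those `ψ ∈ ℝ^I` such that `g_{ψ,T}` is convex and `g_{ψ,T}(ω) ≤ ψ(ω)` for
every `ω ∈ I` that is not a vertex of `T`. -/
def coneTilde : PointedCone ℝ (LatticePoints X Q → ℝ) where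
  carrier := {ψ |
    (∀ x ∈ Q, ∀ y ∈ Q, ∀ a b : ℝ, 0 ≤ a → 0 ≤ b → a + b = 1 →
      interp T ψ (a • x + b • y) ≤ a * interp T ψ x + b * interp T ψ y) ∧
    ∀ ω : LatticePoints X Q, (ω : E) ∉ T.vertices → interp T ψ ω ≤ ψ ω}
  zero_mem' := by simp [interp_zero]
  add_mem' := by
    rintro ψ χ ⟨h1, h2⟩ ⟨h3, h4⟩
    refine ⟨fun x hx y hy a b ha hb hab => ?_, fun ω hω => ?_⟩
    · have := h1 x hx y hy a b ha hb hab
      have := h3 x hx y hy a b ha hb hab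
      simp only [interp_add, Pi.add_apply]
      linarith
    · rw [interp_add]; exact add_le_add (h2 ω hω) (h4 ω hω)
  smul_mem' := by
    rintro ⟨r, hr⟩ ψ ⟨h1, h2⟩
    have e : (⟨r, hr⟩ : {c : ℝ // 0 ≤ c}) • ψ = r • ψ := rfl
    refine ⟨fun x hx y hy a b ha hb hab => ?_, fun ω hω => ?_⟩
    · have := mul_le_mul_of_nonneg_left (h1 x hx y hy a b ha hb hab) hr
      rw [e, interp_smul]
      simp only [Pi.smul_apply, smul_eq_mul]
      linarith
    · rw [e, interp_smul]; exact mul_le_mul_of_nonneg_left (h2 ω hω) hr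

/-- The cone `C(T) ⊆ 𝕃*_ℝ` of the secondary fan: the image of `C̃(T)`. -/
def secondaryCone : PointedCone ℝ (LStar X Q) :=
  (coneTilde X Q T).map (affSubspace X Q).mkQ

/-- A cone has maximal dimension if it spans the ambient space. -/
def IsMaximalCone (C : PointedCone ℝ (LStar X Q)) : Prop :=
  Submodule.span ℝ (C : Set (LStar X Q)) = ⊤

variable {X Q} in
/-- The dual cone `C^∨ ⊆ 𝕃_ℝ`. -/
def dualCone (C : PointedCone ℝ (LStar X Q)) : PointedCone ℝ (LSpace X Q) :=
  PointedCone.dual (Module.Dual.eval ℝ (LStar X Q)) (C : Set (LStar X Q))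

/-! ### The lattices and the monoids -/

/-- The functions `ψ ∈ ℝ^I` that correspond to elements of `PA(T, ℤ) × ℤ^{I_∅}` under
`ψ ↦ (g_{ψ,T}, (ψ(ω) - g_{ψ,T}(ω))_{ω ∈ I_∅})`, where `I_∅` is the set of the points of `I` that
are not vertices of `T`. -/
def integralFunctions : Set (LatticePoints X Q → ℝ) :=
  {ψ | (∀ s ∈ T.facets, ∃ a : E →ᵃ[ℝ] ℝ, IsIntegralAffine X a ∧
        Set.EqOn (interp T ψ) a (convexHull ℝ (s : Set E))) ∧
      ∀ ω : LatticePoints X Q, (ω : E) ∉ T.vertices → ∃ n : ℤ, ψ ω - interp T ψ ω = n}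

/-- The lattice `𝕃_T ⊆ 𝕃_ℝ`, the dual of `𝕃*_T = (PA(T, ℤ) / Aff) × ℤ^{I_∅}`. -/
def latticeL : AddSubgroup (LSpace X Q) where
  carrier := {f | ∀ ψ ∈ integralFunctions X Q T, ∃ n : ℤ, f ((affSubspace X Q).mkQ ψ) = n}
  zero_mem' := fun _ _ => ⟨0, by simp⟩
  add_mem' := by
    intro f g hf hg ψ hψ
    obtain ⟨m, hm⟩ := hf ψ hψ
    obtain ⟨n, hn⟩ := hg ψ hψ
    exact ⟨m + n, by rw [LinearMap.add_apply, hm, hn]; push_cast; rfl⟩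
  neg_mem' := by
    intro f hf ψ hψ
    obtain ⟨m, hm⟩ := hf ψ hψ
    exact ⟨-m, by rw [LinearMap.neg_apply, hm]; push_cast; rfl⟩

/-- The toric monoid `S_{C(T)} = C(T)^∨ ∩ 𝕃_T`. -/
def monoidCone : AddSubmonoid (LSpace X Q) :=
  (dualCone (secondaryCone X Q T)).toAddSubmonoid ⊓ (latticeL X Q T).toAddSubmonoid

variable (T₁ T₂ : SimplicialComplex ℝ E)

/-- The lattice `𝕃_τ` generated by `S_{C(T₁)}^gp` and `S_{C(T₂)}^gp`. -/
def latticeTau : AddSubgroup (LSpace X Q) :=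
  AddSubgroup.closure (monoidCone X Q T₁ : Set (LSpace X Q)) ⊔
    AddSubgroup.closure (monoidCone X Q T₂ : Set (LSpace X Q))

/-- The monoid `S_τ = (C(T₁)^∨ + C(T₂)^∨) ∩ 𝕃_τ` of `τ = C(T₁) ∩ C(T₂)`. -/
def monoidTau : AddSubmonoid (LSpace X Q) :=
  (dualCone (secondaryCone X Q T₁) ⊔ dualCone (secondaryCone X Q T₂)).toAddSubmonoid ⊓
    (latticeTau X Q T₁ T₂).toAddSubmonoid

/-- The group `S_τ^*` of invertible elements of `S_τ`, as a subgroup of `𝕃_ℝ`. -/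
def unitsTau : AddSubgroup (LSpace X Q) := (monoidTau X Q T₁ T₂).support

end fan

/-! ### The universal function -/

section universal

variable {X : Submodule ℤ E} {Q : Set E} {ι : Type*} [Fintype ι]

/-- The full-dimensional simplex with vertices `σ i` is regular: the `(σ i, 1)` form a basis of the
free abelian group `𝕏 ≅ X × ℤ`. -/
def IsRegularSimplex (X : Submodule ℤ E) (σ : AffineBasis ι ℝ E) : Prop :=
  LinearIndependent ℤ (fun i => ((σ i, 1) : E × ℤ)) ∧
    Submodule.span ℤ (Set.range fun i => ((σ i, 1) : E × ℤ)) = X.prod ⊤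

/-- `L_σ(ψ)`: the affine function on `E` that agrees with `ψ` at the vertices of `σ`. -/
def affineExtension (σ : AffineBasis ι ℝ E) (hσ : ∀ i, σ i ∈ Q ∧ σ i ∈ X)
    (ψ : LatticePoints X Q → ℝ) : E →ᵃ[ℝ] ℝ :=
  ∑ i, ψ ⟨σ i, hσ i⟩ • σ.coord i

theorem affineExtension_apply (σ : AffineBasis ι ℝ E) (hσ : ∀ i, σ i ∈ Q ∧ σ i ∈ X)
    (ψ : LatticePoints X Q → ℝ) (x : E) :
    affineExtension σ hσ ψ x = ∑ i, ψ ⟨σ i, hσ i⟩ * σ.coord i x := by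
  have h := map_sum (AddMonoidHom.mk' (fun f : E →ᵃ[ℝ] ℝ => f x) fun _ _ => rfl)
    (fun i => ψ ⟨σ i, hσ i⟩ • σ.coord i) Finset.univ
  exact h.trans (Finset.sum_congr rfl fun i _ => by simp)

theorem affineExtension_of_affine (σ : AffineBasis ι ℝ E) (hσ : ∀ i, σ i ∈ Q ∧ σ i ∈ X)
    (ψ : LatticePoints X Q → ℝ) (a : E →ᵃ[ℝ] ℝ) (h : ∀ ω, ψ ω = a ω) (x : E) :
    affineExtension σ hσ ψ x = a x := by
  have hx := σ.affineCombination_coord_eq_self x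
  have h1 := Finset.univ.map_affineCombination σ (fun i => σ.coord i x)
    (σ.sum_coord_apply_eq_one x) a
  rw [hx, Finset.univ.affineCombination_eq_linear_combination _ _
    (σ.sum_coord_apply_eq_one x)] at h1
  rw [affineExtension_apply, h1]
  exact Finset.sum_congr rfl fun i _ => by
    rw [h ⟨σ i, hσ i⟩, Function.comp_apply, smul_eq_mul, mul_comm]

/-- The map `Ψ : I → 𝕃_ℝ` with `⟨ψ̄, Ψ(ω)⟩ = ψ(ω) - L_σ(ψ)(ω)` for all `ψ ∈ ℝ^I`. -/
def Psi (σ : AffineBasis ι ℝ E) (hσ : ∀ i, σ i ∈ Q ∧ σ i ∈ X) (ω : LatticePoints X Q) :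
    LSpace X Q :=
  (affSubspace X Q).liftQ
    { toFun := fun ψ => ψ ω - affineExtension σ hσ ψ ω
      map_add' := fun ψ χ => by
        simp only [affineExtension_apply, Pi.add_apply, add_mul, Finset.sum_add_distrib]
        ring
      map_smul' := fun r ψ => by
        simp only [affineExtension_apply, Pi.smul_apply, smul_eq_mul, mul_assoc,
          ← Finset.mul_sum, RingHom.id_apply]
        ring }
    (by
      rintro ψ ⟨a, ha⟩
      simp only [LinearMap.mem_ker, LinearMap.coe_mk, AddHom.coe_mk]
      rw [affineExtension_of_affine σ hσ ψ a ha, ha, sub_self])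

/-- `g_{Ψ,T₁} - g_{Ψ,T₂} : Q → 𝕃_ℝ`. -/
def wallDifference (σ : AffineBasis ι ℝ E) (hσ : ∀ i, σ i ∈ Q ∧ σ i ∈ X)
    (T₁ T₂ : SimplicialComplex ℝ E) (x : E) : LSpace X Q :=
  interp T₁ (Psi σ hσ) x - interp T₂ (Psi σ hσ) x

end universal

end SecondaryFan

end

/-! A functional in `LSpace` is the same thing as an affine relation `u` between the points of `I`,
and everything is tested on such relations. For `ψ` in `coneTilde`, the function `g_{ψ,T}` is the
lower hull of `ψ`; hence `ψ` belongs to that cone exactly when it pairs nonnegatively with every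
relation that is nonnegative off some simplex of `T` (`mem_coneTilde_iff`). So each secondary cone
is dual to a finitely generated cone, and Minkowski–Weyl duality yields `τ^∨` (`dualCone_inf`). The
face property comes from comparing the two lower hulls (`isFaceOf_secondaryCone`).

At `x ∈ Q` the wall difference is, up to sign, the functional of the difference of the barycentric
coordinates of `x` in `T₂` and `T₁`. This relation is nonnegative off a simplex of `T₁` and
nonpositive off a simplex of `T₂`, so it lies in `C(T₁)^∨` and its negative in `C(T₂)^∨`. If it is
integral, it is a unit (`functional_mem_unitsTau`). At rational `x` the coordinates are rational and
denominators can be cleared; at real `x` the relation is approximated by rational ones with the same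
signs (`exists_rat_approx`). -/

noncomputable section

namespace PointedCone

open Module

/-! ### Minkowski–Weyl duality for finitely generated cones -/

section MinkowskiWeyl

variable {K M N : Type*} [Field K] [LinearOrder K] [IsStrictOrderedRing K]
  [AddCommGroup M] [Module K M] [AddCommGroup N] [Module K N] {p : M →ₗ[K] N →ₗ[K] K}

theorem DualFG.bot [FiniteDimensional K N] (hp : Function.Surjective p) :
    (⊥ : PointedCone K N).DualFG p := by
  classical
  let b := Module.finBasis K N
  choose f hf using fun i => hp (b.coord i)
  have hfin : (Set.range f ∪ Set.range fun i => -f i).Finite :=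
    (Set.finite_range _).union (Set.finite_range _)
  have : dual p (Set.range f ∪ Set.range fun i => -f i) = ⊥ := by
    refine le_antisymm (fun y hy => ?_) bot_le
    rw [Submodule.mem_bot, ← b.forall_coord_eq_zero_iff]
    intro i
    refine le_antisymm ?_ ?_
    · have := hy (Or.inr ⟨i, rfl⟩)
      rw [map_neg, LinearMap.neg_apply, hf] at this
      linarith
    · have := hy (Or.inl ⟨i, rfl⟩)
      rwa [hf] at this
  exact this ▸ DualFG.dual_of_finite p hfin

/-- One step of Fourier–Motzkin elimination. -/
theorem DualFG.hull_insert {s : Set N} (hs : (hull K s).DualFG p) (x : N) :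
    (hull K (insert x s)).DualFG p := by
  classical
  obtain ⟨t, ht⟩ := hs
  let A : Set M := {m | m ∈ t ∧ 0 ≤ p m x}
  let B : Set M := (fun q : M × M => p q.2 x • q.1 - p q.1 x • q.2) ''
    {q | (q.1 ∈ t ∧ p q.1 x < 0) ∧ (q.2 ∈ t ∧ 0 < p q.2 x)}
  have hA : A.Finite := t.finite_toSet.subset fun m hm => hm.1
  have hB : B.Finite := ((t ×ˢ t).finite_toSet.subset fun q hq => by
    simpa using ⟨hq.1.1, hq.2.1⟩).image _
  suffices dual p (A ∪ B) = hull K (insert x s) from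
    this ▸ DualFG.dual_of_finite p (hA.union hB)
  ext y
  rw [hull, Submodule.mem_span_insert]
  constructor
  · intro hy
    -- Sought is `a ≥ 0` with `y - a • x` in the old cone. Each `m ∈ t` negative at `x` bounds `a`
    -- below, each positive one bounds it above. The largest lower bound (including `0`) is taken;
    -- `B` makes it compatible with the upper bounds.
    obtain ⟨a, ha, hmax⟩ := Finset.exists_max_image
      (insert 0 ((t.filter fun m => p m x < 0).image fun m => p m y / p m x)) _root_.id
      (Finset.insert_nonempty _ _)
    have ha0 : 0 ≤ a := hmax 0 (Finset.mem_insert_self _ _)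
    have hlow : ∀ m ∈ t, p m x < 0 → p m y / p m x ≤ a := fun m hm hmx =>
      hmax _ (Finset.mem_insert_of_mem (Finset.mem_image_of_mem _ (by simp [hm, hmx])))
    have hup : ∀ m ∈ t, 0 < p m x → a * p m x ≤ p m y := by
      intro m hm hmx
      rcases Finset.mem_insert.1 ha with rfl | ha
      · simpa using hy (Or.inl ⟨hm, hmx.le⟩)
      · obtain ⟨n, hn, rfl⟩ := Finset.mem_image.1 ha
        rw [Finset.mem_filter] at hn
        have := hy (Or.inr ⟨(n, m), ⟨hn, hm, hmx⟩, rfl⟩)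
        simp only [map_sub, map_smul, LinearMap.sub_apply, LinearMap.smul_apply,
          smul_eq_mul] at this
        rw [div_mul_eq_mul_div, div_le_iff_of_neg hn.2]
        linarith
    refine ⟨⟨a, ha0⟩, y - a • x, ?_, ?_⟩
    · change y - a • x ∈ hull K s
      rw [← ht]
      intro m hm
      rw [map_sub, map_smul, smul_eq_mul, sub_nonneg]
      rcases lt_trichotomy (p m x) 0 with h | h | h
      · exact (div_le_iff_of_neg h).1 (hlow m hm h)
      · rw [h, mul_zero]
        exact hy (Or.inl ⟨hm, h.ge⟩)
      · exact hup m hm h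
    · rw [Nonneg.mk_smul]
      abel
  · rintro ⟨⟨a, ha⟩, z, hz, rfl⟩
    change z ∈ hull K s at hz
    rw [← ht] at hz
    rw [Nonneg.mk_smul]
    rintro _ (⟨hm, hmx⟩ | ⟨⟨m, n⟩, ⟨⟨hm, hmx⟩, hn, hnx⟩, rfl⟩)
    · rw [map_add, map_smul, smul_eq_mul]
      exact add_nonneg (mul_nonneg ha hmx) (hz hm)
    · have h1 := mul_nonneg hnx.le (hz hm)
      have h2 := mul_nonneg (neg_nonneg.2 hmx.le) (hz hn)
      simp only [map_sub, map_add, map_smul, LinearMap.sub_apply, LinearMap.smul_apply,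
        smul_eq_mul]
      linarith

/-- **Weyl's theorem**: a finitely generated cone is polyhedral. -/
theorem FG.dualFG [FiniteDimensional K N] (hp : Function.Surjective p) {C : PointedCone K N}
    (hC : C.FG) : C.DualFG p := by
  classical
  obtain ⟨s, rfl⟩ := hC
  induction s using Finset.induction_on with
  | empty => simpa using DualFG.bot hp
  | insert x s _ ih => simpa using DualFG.hull_insert ih x

theorem FG.dual_dual_flip [FiniteDimensional K N] (hp : Function.Surjective p)
    {C : PointedCone K N} (hC : C.FG) : dual p (dual p.flip (C : Set N)) = C :=
  DualFG.dual_dual_flip (FG.dualFG hp hC)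

/-- **Minkowski's theorem**: a polyhedral cone is finitely generated. -/
theorem fg_dual_of_finite [FiniteDimensional K M] [FiniteDimensional K N]
    (hp : Function.Surjective p) (hp' : Function.Surjective p.flip) {s : Set M} (hs : s.Finite) :
    (dual p s).FG := by
  -- By Weyl, `hull K s` is the dual of a finite `t`; its dual is then the bidual of `hull K t`,
  -- which is `hull K t` itself.
  obtain ⟨t, ht⟩ := FG.dualFG (p := p.flip) hp' (Submodule.fg_span hs : (hull K s).FG)
  refine ⟨t, ?_⟩
  have h := FG.dual_dual_flip hp (Submodule.fg_span t.finite_toSet : (hull K (t : Set N)).FG)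
  rw [dual_hull, ht] at h
  rw [← dual_hull s]
  exact h.symm

end MinkowskiWeyl

end PointedCone

end

noncomputable section

namespace SecondaryFan

open Geometry

/-! ### Affine relations and barycentric coordinates -/

section barycentric

theorem sum_face {E : Type*} [AddCommGroup E] {X : Submodule ℤ E} {Q : Set E}
    [Fintype (LatticePoints X Q)] {M : Type*} [AddCommMonoid M] {s : Finset E}
    (hs : ∀ y ∈ s, y ∈ Q ∧ y ∈ X)
    (f : E → M) [DecidableEq E] :
    ∑ ω : LatticePoints X Q, (if (ω : E) ∈ s then f ω else 0) = ∑ y ∈ s, f y := by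
  rw [← Finset.sum_filter]
  refine Finset.sum_bij (fun ω _ => (ω : E)) (fun ω hω => (Finset.mem_filter.1 hω).2)
    (fun a _ b _ h => Subtype.ext h) (fun y hy => ⟨⟨y, hs y hy⟩, by simpa using hy, rfl⟩)
    fun _ _ => rfl

variable {E : Type*} [AddCommGroup E] [Module ℝ E] {X : Submodule ℤ E} {Q : Set E}
  {T : SimplicialComplex ℝ E}

theorem IsTriangulation.mem_of_mem_face (hT : IsTriangulation X Q T) {s : Finset E}
    (hs : s ∈ T.faces) {y : E} (hy : y ∈ s) : y ∈ Q ∧ y ∈ X :=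
  ⟨hT.space_eq ▸ T.subset_space hs hy, hT.vertices_subset y
    (T.down_closed hs (Finset.singleton_subset_iff.2 hy) (Finset.singleton_nonempty y))⟩

variable [Fintype (LatticePoints X Q)]

/-- `u` is the family of coefficients of an affine relation between the points of `I`. -/
def IsAffineRelation (u : LatticePoints X Q → ℝ) : Prop :=
  ∑ ω, u ω = 0 ∧ ∑ ω, u ω • (ω : E) = 0

theorem IsAffineRelation.sum_mul_affine {u : LatticePoints X Q → ℝ} (hu : IsAffineRelation u)
    (a : E →ᵃ[ℝ] ℝ) : ∑ ω, u ω * a ω = 0 := by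
  have h : ∀ ω : LatticePoints X Q, u ω * a ω = a.linear (u ω • (ω : E)) + u ω * a 0 := by
    intro ω
    have : a ω = a.linear ω + a 0 := congrFun a.decomp (ω : E)
    rw [this, map_smul, smul_eq_mul]
    ring
  simp_rw [h, Finset.sum_add_distrib, ← map_sum, ← Finset.sum_mul, hu.1, hu.2]
  simp

theorem IsAffineRelation.sub {u v : LatticePoints X Q → ℝ} (h₁ : ∑ ω, u ω = ∑ ω, v ω)
    (h₂ : ∑ ω, u ω • (ω : E) = ∑ ω, v ω • (ω : E)) : IsAffineRelation (u - v) :=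
  ⟨by simp [h₁], by simp [sub_smul, h₂]⟩

theorem IsAffineRelation.smul {u : LatticePoints X Q → ℝ} (hu : IsAffineRelation u) (r : ℝ) :
    IsAffineRelation (r • u) :=
  ⟨by simp [← Finset.mul_sum, hu.1], by simp [mul_smul, ← Finset.smul_sum, hu.2]⟩

theorem IsAffineRelation.neg {u : LatticePoints X Q → ℝ} (hu : IsAffineRelation u) :
    IsAffineRelation (-u) :=
  ⟨by simp [hu.1], by simp [hu.2]⟩

theorem IsAffineRelation.eq_zero {s : Finset E} (hs : AffineIndependent ℝ ((↑) : s → E))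
    {u : LatticePoints X Q → ℝ} (hu : IsAffineRelation u) (hus : ∀ ω, u ω ≠ 0 → (ω : E) ∈ s) :
    u = 0 := by
  classical
  let A := Finset.univ.filter fun ω : LatticePoints X Q => (ω : E) ∈ s
  let e : A ↪ s := ⟨fun ω => ⟨ω.1, (Finset.mem_filter.1 ω.2).2⟩, fun a b h =>
    Subtype.ext (Subtype.ext (congrArg (fun z : s => (z : E)) h))⟩
  have hi := hs.comp_embedding e
  rw [affineIndependent_iff] at hi
  have hA : ∀ ω ∉ A, u ω = 0 := fun ω hω => by
    by_contra h
    exact hω (Finset.mem_filter.2 ⟨Finset.mem_univ _, hus ω h⟩)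
  have h0 := hi Finset.univ (fun ω => u ω.1) ?_ ?_
  · funext ω
    by_cases hω : ω ∈ A
    · exact h0 ⟨ω, hω⟩ (Finset.mem_univ _)
    · exact hA ω hω
  · rw [Finset.sum_coe_sort A u, Finset.sum_subset A.subset_univ fun ω _ h => hA ω h]
    exact hu.1
  · refine Eq.trans (Finset.sum_coe_sort A fun ω => u ω • (ω : E)) ?_
    rw [Finset.sum_subset A.subset_univ fun ω _ h => by rw [hA ω h, zero_smul]]
    exact hu.2

theorem exists_weights_of_mem_convexHull {s : Finset E} (hs : ∀ y ∈ s, y ∈ Q ∧ y ∈ X) {x : E}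
    (hx : x ∈ convexHull ℝ (s : Set E)) :
    ∃ w : LatticePoints X Q → ℝ, (∀ ω, w ω ≠ 0 → (ω : E) ∈ s) ∧ (∀ ω, 0 ≤ w ω) ∧
      ∑ ω, w ω = 1 ∧ ∑ ω, w ω • (ω : E) = x := by
  classical
  obtain ⟨c, hc0, hc1, rfl⟩ := Finset.mem_convexHull'.1 hx
  refine ⟨fun ω => if (ω : E) ∈ s then c ω else 0, fun ω h => ?_, fun ω => ?_, ?_, ?_⟩
  · by_contra h'
    simp [h'] at h
  · dsimp only
    split_ifs with h
    exacts [hc0 _ h, le_rfl]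
  · rw [sum_face hs, hc1]
  · simp_rw [ite_smul, zero_smul]
    exact sum_face hs fun y => c y • y

theorem isBarycentric_iff {x : E} {w : LatticePoints X Q →₀ ℝ} :
    IsBarycentric T x w ↔ (∃ s ∈ T.faces, ∀ ω, w ω ≠ 0 → (ω : E) ∈ s) ∧ (∀ ω, 0 ≤ w ω) ∧
      ∑ ω, w ω = 1 ∧ ∑ ω, w ω • (ω : E) = x := by
  simp [IsBarycentric, Finsupp.sum_fintype]

/-- Since the simplices cover `Q`, the default value `0` of `baryCoords` is never taken there. -/
theorem IsTriangulation.isBarycentric_baryCoords (hT : IsTriangulation X Q T) {x : E}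
    (hx : x ∈ Q) : IsBarycentric T x (baryCoords X Q T x) := by
  have h : ∃ w : LatticePoints X Q →₀ ℝ, IsBarycentric T x w := by
    obtain ⟨s, hs, hxs⟩ := SimplicialComplex.mem_space_iff.1 (hT.space_eq ▸ hx)
    obtain ⟨w, h1, h2⟩ := exists_weights_of_mem_convexHull
      (fun y hy => hT.mem_of_mem_face hs hy) hxs
    exact ⟨Finsupp.equivFunOnFinite.symm w, isBarycentric_iff.2 ⟨⟨s, hs, h1⟩, h2⟩⟩
  rw [baryCoords, dif_pos h]
  exact h.choose_spec

theorem mem_convexHull_of_weights {s : Finset E} {w : LatticePoints X Q → ℝ}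
    (hs : ∀ ω, w ω ≠ 0 → (ω : E) ∈ s) (h0 : ∀ ω, 0 ≤ w ω) (h1 : ∑ ω, w ω = 1) :
    ∑ ω, w ω • (ω : E) ∈ convexHull ℝ (s : Set E) := by
  classical
  rw [← Finset.sum_subset (Finset.subset_univ (Finset.univ.filter fun ω => w ω ≠ 0))
    fun ω _ h => by simp at h; simp [h]]
  refine (convex_convexHull ℝ _).sum_mem (fun ω _ => h0 ω) ?_
    fun ω hω => subset_convexHull ℝ _ (hs ω (Finset.mem_filter.1 hω).2)
  rw [Finset.sum_filter_ne_zero, h1]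

/-- The point lies in the hull of `s ∩ t`. Weights supported there are admissible for both `s` and
`t`, and affine independence of each forces `w` and `v` to agree with them. -/
theorem IsTriangulation.isBarycentric_unique (hT : IsTriangulation X Q T) {x : E}
    {w v : LatticePoints X Q →₀ ℝ} (hw : IsBarycentric T x w) (hv : IsBarycentric T x v) :
    w = v := by
  classical
  obtain ⟨⟨s, hs, hws⟩, hw0, hw1, hwx⟩ := isBarycentric_iff.1 hw
  obtain ⟨⟨t, ht, hvt⟩, hv0, hv1, hvx⟩ := isBarycentric_iff.1 hv
  have hx : x ∈ convexHull ℝ ((s ∩ t : Finset E) : Set E) := by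
    rw [Finset.coe_inter]
    exact T.inter_subset_convexHull hs ht ⟨hwx ▸ mem_convexHull_of_weights hws hw0 hw1,
      hvx ▸ mem_convexHull_of_weights hvt hv0 hv1⟩
  obtain ⟨c, hcs, -, hc1, hcx⟩ := exists_weights_of_mem_convexHull
    (fun y hy => hT.mem_of_mem_face hs (Finset.mem_inter.1 hy).1) hx
  have key : ∀ {s' : Finset E}, s' ∈ T.faces → s ∩ t ⊆ s' → ∀ w' : LatticePoints X Q → ℝ,
      (∀ ω, w' ω ≠ 0 → (ω : E) ∈ s') → ∑ ω, w' ω = 1 → ∑ ω, w' ω • (ω : E) = x → w' = c := by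
    intro s' hs' hsub w' h1 h2 h3
    refine sub_eq_zero.1 (IsAffineRelation.eq_zero (T.indep hs')
      (IsAffineRelation.sub (h2.trans hc1.symm) (h3.trans hcx.symm)) fun ω hω => ?_)
    by_cases h : w' ω = 0
    · exact hsub (hcs ω fun h' => hω (by simp [h, h']))
    · exact h1 ω h
  refine DFunLike.coe_injective ((key hs Finset.inter_subset_left w hws hw1 hwx).trans
    (key ht Finset.inter_subset_right v hvt hv1 hvx).symm)

section interp

variable {M : Type*} [AddCommGroup M] [Module ℝ M]

theorem interp_eq_sum_baryCoords (ψ : LatticePoints X Q → M) (x : E) :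
    interp T ψ x = ∑ ω, baryCoords X Q T x ω • ψ ω := by
  rw [interp, Finsupp.sum_fintype _ _ (by simp)]

theorem IsTriangulation.interp_eq_sum (hT : IsTriangulation X Q T) (ψ : LatticePoints X Q → M)
    {s : Finset E} (hs : s ∈ T.faces) {w : LatticePoints X Q → ℝ}
    (hws : ∀ ω, w ω ≠ 0 → (ω : E) ∈ s) (h0 : ∀ ω, 0 ≤ w ω) (h1 : ∑ ω, w ω = 1) :
    interp T ψ (∑ ω, w ω • (ω : E)) = ∑ ω, w ω • ψ ω := by
  have hw : IsBarycentric T (∑ ω, w ω • (ω : E)) (Finsupp.equivFunOnFinite.symm w) :=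
    isBarycentric_iff.2 ⟨⟨s, hs, hws⟩, h0, h1, rfl⟩
  have hx : ∑ ω, w ω • (ω : E) ∈ Q :=
    hT.space_eq.le <| T.convexHull_subset_space hs (mem_convexHull_of_weights hws h0 h1)
  rw [interp_eq_sum_baryCoords, hT.isBarycentric_unique (hT.isBarycentric_baryCoords hx) hw]
  rfl

theorem IsTriangulation.interp_vertex (hT : IsTriangulation X Q T) (ψ : LatticePoints X Q → M)
    {ω : LatticePoints X Q} (hω : (ω : E) ∈ T.vertices) : interp T ψ ω = ψ ω := by
  classical
  have := hT.interp_eq_sum ψ (w := Pi.single ω 1) hω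
    (fun ω' h => by
      by_contra h'
      exact h (Pi.single_eq_of_ne (fun e => h' (by simp [e])) _))
    (fun ω' => by
      by_cases h : ω' = ω
      · subst h; simp
      · simp [h]) (by simp)
  simpa [Pi.single_apply] using this

end interp

end barycentric

end SecondaryFan

end

noncomputable section

namespace SecondaryFan

open Geometry

/-! ### Secondary cones as dual cones -/

section cones

variable {E : Type*} [AddCommGroup E] [Module ℝ E] {X : Submodule ℤ E} {Q : Set E}
  [Fintype (LatticePoints X Q)] {T T₁ T₂ : SimplicialComplex ℝ E} {ψ : LatticePoints X Q → ℝ}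

theorem sum_smul_mem_of_convex (hQ : Convex ℝ Q) {w : LatticePoints X Q → ℝ}
    (h0 : ∀ ω, 0 ≤ w ω) (h1 : ∑ ω, w ω = 1) : ∑ ω, w ω • (ω : E) ∈ Q :=
  hQ.sum_mem (fun ω _ => h0 ω) h1 fun ω _ => ω.2.1

/-- A function lies in `C̃(T)` when `g_{ψ,T}` is the lower convex hull of `ψ`. -/
theorem IsTriangulation.interp_le_of_mem_coneTilde (hT : IsTriangulation X Q T)
    (hQ : Convex ℝ Q) (hψ : ψ ∈ coneTilde X Q T) {w : LatticePoints X Q → ℝ}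
    (h0 : ∀ ω, 0 ≤ w ω) (h1 : ∑ ω, w ω = 1) :
    interp T ψ (∑ ω, w ω • (ω : E)) ≤ ∑ ω, w ω * ψ ω := by
  have hc : ConvexOn ℝ Q (interp T ψ) :=
    ⟨hQ, fun x hx y hy a b ha hb hab => hψ.1 x hx y hy a b ha hb hab⟩
  refine (hc.map_sum_le (fun ω _ => h0 ω) h1 fun ω _ => ω.2.1).trans
    (Finset.sum_le_sum fun ω _ => mul_le_mul_of_nonneg_left ?_ (h0 ω))
  by_cases hω : (ω : E) ∈ T.vertices
  · exact (hT.interp_vertex ψ hω).le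
  · exact hψ.2 ω hω

/-- Write `u = w - v` with positive part `w` and negative part `v`, the latter supported on `s`.
After scaling, both represent the same point: `v` computes the interpolation there, and `w` gives a
value at least as large. -/
theorem IsTriangulation.sum_mul_nonneg (hT : IsTriangulation X Q T)
    (hQ : Convex ℝ Q) (hψ : ψ ∈ coneTilde X Q T) {s : Finset E} (hs : s ∈ T.faces)
    {u : LatticePoints X Q → ℝ} (hu : IsAffineRelation u)
    (hus : ∀ ω : LatticePoints X Q, (ω : E) ∉ s → 0 ≤ u ω) : 0 ≤ ∑ ω, u ω * ψ ω := by
  set v : LatticePoints X Q → ℝ := fun ω => max (-u ω) 0 with hv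
  set w : LatticePoints X Q → ℝ := fun ω => max (u ω) 0 with hw
  have huw : ∀ ω, u ω = w ω - v ω := fun ω => by
    rcases le_total (u ω) 0 with h | h <;> simp [hv, hw, h]
  have hv0 : ∀ ω, 0 ≤ v ω := fun ω => le_max_right _ _
  have hw0 : ∀ ω, 0 ≤ w ω := fun ω => le_max_right _ _
  have hvs : ∀ ω, v ω ≠ 0 → (ω : E) ∈ s := fun ω h => by
    by_contra h'
    exact h (max_eq_right (neg_nonpos.2 (hus ω h')))
  have h1 : ∑ ω, w ω = ∑ ω, v ω := by
    have := hu.1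
    simp_rw [huw, Finset.sum_sub_distrib] at this
    linarith
  have h2 : ∑ ω, w ω • (ω : E) = ∑ ω, v ω • (ω : E) := by
    have := hu.2
    simp_rw [huw, sub_smul, Finset.sum_sub_distrib] at this
    exact sub_eq_zero.1 this
  have h3 : ∑ ω, u ω * ψ ω = ∑ ω, w ω * ψ ω - ∑ ω, v ω * ψ ω := by
    simp_rw [huw, sub_mul, Finset.sum_sub_distrib]
  rcases (Finset.sum_nonneg fun ω (_ : ω ∈ Finset.univ) => hv0 ω).eq_or_lt' with ht | ht
  -- With zero total mass no scaling is possible, but then `w` and `v` both vanish.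
  · have hv' := (Finset.sum_eq_zero_iff_of_nonneg fun ω _ => hv0 ω).1 ht
    have hw' := (Finset.sum_eq_zero_iff_of_nonneg fun ω _ => hw0 ω).1 (h1.trans ht)
    rw [h3, Finset.sum_eq_zero fun ω h => by rw [hw' ω h, zero_mul],
      Finset.sum_eq_zero fun ω h => by rw [hv' ω h, zero_mul], sub_zero]
  · set t := ∑ ω, v ω
    have ht' := inv_nonneg.2 ht.le
    have e1 := hT.interp_eq_sum ψ hs (w := fun ω => t⁻¹ * v ω)
      (fun ω h => hvs ω (right_ne_zero_of_mul h)) (fun ω => mul_nonneg ht' (hv0 ω))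
      (by rw [← Finset.mul_sum]; exact inv_mul_cancel₀ ht.ne')
    have e2 := hT.interp_le_of_mem_coneTilde hQ hψ (w := fun ω => t⁻¹ * w ω)
      (fun ω => mul_nonneg ht' (hw0 ω))
      (by rw [← Finset.mul_sum, h1]; exact inv_mul_cancel₀ ht.ne')
    simp_rw [mul_smul, ← Finset.smul_sum] at e1 e2
    rw [h2, e1] at e2
    simp_rw [smul_eq_mul, mul_assoc, ← Finset.mul_sum] at e2
    rw [h3]
    have := le_of_mul_le_mul_left e2 (inv_pos.2 ht)
    linarith

/-- Convex weights minus the barycentric coordinates of the same point form a relation that is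
nonnegative off a simplex; this gives the lower hull inequality `key`. Mixtures of two barycentric
families give convexity, and point masses give the bound at each `ω`. -/
theorem IsTriangulation.mem_coneTilde_of_sum_mul_nonneg (hT : IsTriangulation X Q T)
    (hQ : Convex ℝ Q)
    (h : ∀ s ∈ T.faces, ∀ u : LatticePoints X Q → ℝ, IsAffineRelation u →
      (∀ ω : LatticePoints X Q, (ω : E) ∉ s → 0 ≤ u ω) → 0 ≤ ∑ ω, u ω * ψ ω) :
    ψ ∈ coneTilde X Q T := by
  classical
  have key : ∀ w : LatticePoints X Q → ℝ, (∀ ω, 0 ≤ w ω) → ∑ ω, w ω = 1 →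
      interp T ψ (∑ ω, w ω • (ω : E)) ≤ ∑ ω, w ω * ψ ω := by
    intro w h0 h1
    obtain ⟨⟨s, hs, hbs⟩, -, hb1, hbx⟩ := isBarycentric_iff.1
      (hT.isBarycentric_baryCoords (sum_smul_mem_of_convex hQ h0 h1))
    have := h s hs _ (IsAffineRelation.sub (h1.trans hb1.symm) hbx.symm) fun ω hω => by
      rw [Pi.sub_apply, of_not_not (mt (hbs ω) hω), sub_zero]
      exact h0 ω
    simp_rw [Pi.sub_apply, sub_mul, Finset.sum_sub_distrib] at this
    rw [interp_eq_sum_baryCoords]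
    simp_rw [smul_eq_mul]
    linarith
  refine ⟨fun x hx y hy a b ha hb hab => ?_, fun ω _ => ?_⟩
  · obtain ⟨-, hx0, hx1, hxx⟩ := isBarycentric_iff.1 (hT.isBarycentric_baryCoords hx)
    obtain ⟨-, hy0, hy1, hyy⟩ := isBarycentric_iff.1 (hT.isBarycentric_baryCoords hy)
    have := key (fun ω => a * baryCoords X Q T x ω + b * baryCoords X Q T y ω)
      (fun ω => add_nonneg (mul_nonneg ha (hx0 ω)) (mul_nonneg hb (hy0 ω)))
      (by rw [Finset.sum_add_distrib, ← Finset.mul_sum, ← Finset.mul_sum, hx1, hy1]; linarith)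
    simp_rw [add_smul, add_mul, mul_smul, mul_assoc, Finset.sum_add_distrib, ← Finset.smul_sum,
      ← Finset.mul_sum, hxx, hyy] at this
    simpa only [interp_eq_sum_baryCoords, smul_eq_mul] using this
  · have := key (Pi.single ω 1) (fun ω' => by
      by_cases h : ω' = ω
      · subst h; simp
      · simp [h]) (by simp)
    simpa [Pi.single_apply] using this

theorem IsTriangulation.mem_coneTilde_iff (hT : IsTriangulation X Q T) (hQ : Convex ℝ Q) :
    ψ ∈ coneTilde X Q T ↔ ∀ s ∈ T.faces, ∀ u : LatticePoints X Q → ℝ, IsAffineRelation u →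
      (∀ ω : LatticePoints X Q, (ω : E) ∉ s → 0 ≤ u ω) → 0 ≤ ∑ ω, u ω * ψ ω :=
  ⟨fun hψ _ hs _ hu hus => hT.sum_mul_nonneg hQ hψ hs hu hus,
    hT.mem_coneTilde_of_sum_mul_nonneg hQ⟩

theorem IsAffineRelation.sum_mul_eq_of_mkQ_eq {u φ : LatticePoints X Q → ℝ}
    (hu : IsAffineRelation u) (h : (affSubspace X Q).mkQ φ = (affSubspace X Q).mkQ ψ) :
    ∑ ω, u ω * φ ω = ∑ ω, u ω * ψ ω := by
  obtain ⟨a, ha⟩ := (Submodule.Quotient.eq _).1 h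
  rw [← sub_eq_zero, ← Finset.sum_sub_distrib, ← hu.sum_mul_affine a]
  exact Finset.sum_congr rfl fun ω _ => by rw [← ha ω, Pi.sub_apply, mul_sub]

/-- Pairings with affine relations ignore affine functions, so `coneTilde` is saturated for the
quotient map. -/
theorem IsTriangulation.mkQ_mem_secondaryCone_iff (hT : IsTriangulation X Q T)
    (hQ : Convex ℝ Q) :
    (affSubspace X Q).mkQ ψ ∈ secondaryCone X Q T ↔ ψ ∈ coneTilde X Q T := by
  refine ⟨fun h => ?_, fun h => PointedCone.mem_map.2 ⟨ψ, h, rfl⟩⟩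
  obtain ⟨φ, hφ, e⟩ := PointedCone.mem_map.1 h
  rw [hT.mem_coneTilde_iff hQ] at hφ ⊢
  intro s hs u hu hus
  rw [← hu.sum_mul_eq_of_mkQ_eq e]
  exact hφ s hs u hu hus

/-- On `C(T₁)` the `T₁`-interpolation is at most the `T₂`-interpolation. For a sum also lying in
`C(T₂)` the reverse holds, so equality holds for each summand, and `ψ` inherits the `T₂`-conditions
from its `T₁`-conditions. -/
theorem isFaceOf_secondaryCone (hQ : Convex ℝ Q) (hT₁ : IsTriangulation X Q T₁)
    (hT₂ : IsTriangulation X Q T₂) :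
    (secondaryCone X Q T₁ ⊓ secondaryCone X Q T₂).IsFaceOf (secondaryCone X Q T₁) := by
  refine ⟨inf_le_left, ?_⟩
  intro x y c hx hy hc hxy
  refine ⟨hx, ?_⟩
  obtain ⟨ψ, rfl⟩ := (affSubspace X Q).mkQ_surjective x
  obtain ⟨φ, rfl⟩ := (affSubspace X Q).mkQ_surjective y
  have hxy₂ := hxy.2
  rw [← map_smul, ← map_add] at hxy₂
  change _ ∈ secondaryCone X Q T₂ at hxy₂
  change _ ∈ secondaryCone X Q T₂
  rw [hT₁.mkQ_mem_secondaryCone_iff hQ] at hx hy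
  rw [hT₂.mkQ_mem_secondaryCone_iff hQ] at hxy₂ ⊢
  have hle : ∀ {χ : LatticePoints X Q → ℝ}, χ ∈ coneTilde X Q T₁ → ∀ z ∈ Q,
      interp T₁ χ z ≤ interp T₂ χ z := by
    intro χ hχ z hz
    obtain ⟨-, h0, h1, h2⟩ := isBarycentric_iff.1 (hT₂.isBarycentric_baryCoords hz)
    have := hT₁.interp_le_of_mem_coneTilde hQ hχ h0 h1
    rw [h2] at this
    simpa only [interp_eq_sum_baryCoords, smul_eq_mul] using this
  have heq : ∀ z ∈ Q, interp T₂ ψ z = interp T₁ ψ z := by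
    intro z hz
    refine le_antisymm ?_ (hle hx z hz)
    obtain ⟨-, h0, h1, h2⟩ := isBarycentric_iff.1 (hT₁.isBarycentric_baryCoords hz)
    have h3 := hT₂.interp_le_of_mem_coneTilde hQ hxy₂ h0 h1
    have h4 : ∑ ω, baryCoords X Q T₁ z ω * (c • ψ + φ) ω = interp T₁ (c • ψ + φ) z := by
      simp only [interp_eq_sum_baryCoords, smul_eq_mul]
    rw [h2, h4, interp_add, interp_add, interp_smul, interp_smul] at h3
    simp only [Pi.add_apply, Pi.smul_apply, smul_eq_mul] at h3
    have h5 := hle hy z hz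
    exact le_of_mul_le_mul_left (by linarith) hc
  have hcv := hx.1
  refine ⟨fun z hz z' hz' a b ha hb hab => ?_, fun ω _ => ?_⟩
  · rw [heq z hz, heq z' hz', heq _ (hQ hz hz' ha hb hab)]
    exact hcv z hz z' hz' a b ha hb hab
  · rw [heq ω ω.2.1]
    by_cases hω : (ω : E) ∈ T₁.vertices
    · exact (hT₁.interp_vertex ψ hω).le
    · exact hx.2 ω hω

/-- The element of `𝕃_ℝ` given by an affine relation. -/
def IsAffineRelation.functional {u : LatticePoints X Q → ℝ} (hu : IsAffineRelation u) :
    LSpace X Q :=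
  (affSubspace X Q).liftQ (∑ ω, u ω • LinearMap.proj ω) (by
    rintro ψ ⟨a, ha⟩
    simpa [ha] using hu.sum_mul_affine a)

theorem IsAffineRelation.functional_mkQ {u : LatticePoints X Q → ℝ} (hu : IsAffineRelation u)
    (φ : LatticePoints X Q → ℝ) :
    hu.functional ((affSubspace X Q).mkQ φ) = ∑ ω, u ω * φ ω := by
  simp [functional]

theorem LSpace.apply_mkQ [DecidableEq (LatticePoints X Q)] (f : LSpace X Q)
    (φ : LatticePoints X Q → ℝ) :
    f ((affSubspace X Q).mkQ φ) =
      ∑ ω, f ((affSubspace X Q).mkQ (Pi.single ω 1)) * φ ω := by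
  conv_lhs => rw [← LinearMap.comp_apply, LinearMap.pi_apply_eq_sum_univ]
  refine Finset.sum_congr rfl fun ω _ => ?_
  rw [smul_eq_mul, mul_comm, LinearMap.comp_apply]
  congr 3
  funext i
  simp [Pi.single_apply, eq_comm]

/-- A functional on the quotient kills the constants and the linear forms; these are the two
equations of an affine relation. -/
theorem LSpace.isAffineRelation [DecidableEq (LatticePoints X Q)] (f : LSpace X Q) :
    IsAffineRelation fun ω => f ((affSubspace X Q).mkQ (Pi.single ω 1)) := by
  have h : ∀ a : E →ᵃ[ℝ] ℝ,
      ∑ ω : LatticePoints X Q, f ((affSubspace X Q).mkQ (Pi.single ω 1)) * a ω = 0 := by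
    intro a
    have ha : (fun ω : LatticePoints X Q => a ω) ∈ affSubspace X Q := ⟨a, fun _ => rfl⟩
    rw [← LSpace.apply_mkQ f fun ω => a ω, Submodule.mkQ_apply,
      (Submodule.Quotient.mk_eq_zero _).2 ha, map_zero]
  refine ⟨by simpa using h (AffineMap.const ℝ E 1), ?_⟩
  rw [← Module.forall_dual_apply_eq_zero_iff ℝ]
  intro l
  simpa using h l.toAffineMap

theorem IsTriangulation.finite_faces (hT : IsTriangulation X Q T) : T.faces.Finite := by
  classical
  refine (Finset.univ.image fun ω : LatticePoints X Q => (ω : E)).powerset.finite_toSet.subset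
    fun s hs => Finset.mem_coe.2 (Finset.mem_powerset.2 fun y hy => ?_)
  exact Finset.mem_image.2 ⟨⟨y, hT.mem_of_mem_face hs hy⟩, Finset.mem_univ _, rfl⟩

/-- The secondary cone is the dual of a finitely generated cone. -/
theorem IsTriangulation.exists_fg_dual (hT : IsTriangulation X Q T) (hQ : Convex ℝ Q) :
    ∃ D : PointedCone ℝ (LSpace X Q), D.FG ∧
      secondaryCone X Q T = PointedCone.dual (Module.Dual.eval ℝ (LStar X Q)).flip D := by
  classical
  let e : LatticePoints X Q → LStar X Q := fun ω => (affSubspace X Q).mkQ (Pi.single ω 1)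
  -- `D s` consists of the relations nonnegative off `s`. Finitely many inequalities cut it out, so
  -- Minkowski makes it finitely generated, and so is the sum over the finitely many faces.
  let D : Finset E → PointedCone ℝ (LSpace X Q) := fun s =>
    PointedCone.dual (Module.Dual.eval ℝ (LStar X Q)) (e '' {ω | (ω : E) ∉ s})
  have hfin := hT.finite_faces
  refine ⟨⨆ s ∈ hfin.toFinset, D s, Submodule.fg_biSup hfin.toFinset D fun s _ =>
    PointedCone.fg_dual_of_finite (Module.evalEquiv ℝ (LStar X Q)).surjective
      (fun f => ⟨f, LinearMap.ext fun _ => rfl⟩) (Set.toFinite _), ?_⟩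
  ext ξ
  obtain ⟨ψ, rfl⟩ := (affSubspace X Q).mkQ_surjective ξ
  rw [hT.mkQ_mem_secondaryCone_iff hQ, hT.mem_coneTilde_iff hQ]
  constructor
  · intro h
    suffices ⨆ s ∈ hfin.toFinset, D s ≤
        PointedCone.dual (Module.Dual.eval ℝ (LStar X Q)) {(affSubspace X Q).mkQ ψ} from
      fun f hf => this hf rfl
    refine iSup₂_le fun s hs f hf => ?_
    rintro _ rfl
    change 0 ≤ f _
    rw [LSpace.apply_mkQ f ψ]
    exact h s (hfin.mem_toFinset.1 hs) _ (LSpace.isAffineRelation f)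
      fun ω hω => hf ⟨ω, hω, rfl⟩
  · intro h s hs u hu hus
    rw [← hu.functional_mkQ ψ]
    have hD : D s ≤ ⨆ s ∈ hfin.toFinset, D s :=
      le_iSup₂ (f := fun s (_ : s ∈ hfin.toFinset) => D s) s (hfin.mem_toFinset.2 hs)
    have hf : hu.functional ∈ D s := by
      rintro _ ⟨ω, hω, rfl⟩
      change 0 ≤ hu.functional ((affSubspace X Q).mkQ (Pi.single ω 1))
      rw [hu.functional_mkQ]
      simpa [Pi.single_apply] using hus ω hω
    exact h (hD hf)

/-- `D₁^∨ ∩ D₂^∨ = (D₁ + D₂)^∨`, and all three finitely generated cones equal their biduals, so no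
closure of the sum is needed. -/
theorem dualCone_inf (hQ : Convex ℝ Q) (hT₁ : IsTriangulation X Q T₁)
    (hT₂ : IsTriangulation X Q T₂) :
    dualCone (secondaryCone X Q T₁ ⊓ secondaryCone X Q T₂) =
      dualCone (secondaryCone X Q T₁) ⊔ dualCone (secondaryCone X Q T₂) := by
  obtain ⟨D₁, hD₁, e₁⟩ := hT₁.exists_fg_dual hQ
  obtain ⟨D₂, hD₂, e₂⟩ := hT₂.exists_fg_dual hQ
  have hp : Function.Surjective (Module.Dual.eval ℝ (LStar X Q)) :=
    (Module.evalEquiv ℝ (LStar X Q)).surjective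
  have e₃ : secondaryCone X Q T₁ ⊓ secondaryCone X Q T₂ = PointedCone.dual
      (Module.Dual.eval ℝ (LStar X Q)).flip (D₁ ⊔ D₂ : PointedCone ℝ (LSpace X Q)) := by
    rw [e₁, e₂, PointedCone.dual_sup, PointedCone.dual_union]
  rw [e₃, e₁, e₂]
  simp only [dualCone]
  rw [PointedCone.FG.dual_dual_flip hp hD₁, PointedCone.FG.dual_dual_flip hp hD₂,
    PointedCone.FG.dual_dual_flip hp (hD₁.sup hD₂)]

end cones

end SecondaryFan

end

noncomputable section

namespace SecondaryFan

open Geometry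

/-! ### Integral and rational relations as units -/

section units

variable {E : Type*} [AddCommGroup E] [Module ℝ E] {X : Submodule ℤ E} {Q : Set E}
  [Fintype (LatticePoints X Q)] {T T₁ T₂ : SimplicialComplex ℝ E}

theorem IsTriangulation.exists_facet (hT : IsTriangulation X Q T) {s : Finset E}
    (hs : s ∈ T.faces) : ∃ t ∈ T.facets, s ⊆ t := by
  have hfin := hT.finite_faces
  obtain ⟨t, hst, ht⟩ := hfin.exists_le_maximal hs
  exact ⟨t, ⟨ht.prop, fun r hr htr => htr.antisymm (ht.le_of_ge hr htr)⟩, hst⟩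

/-- Each lattice point lies in a maximal simplex, where the interpolation is an integral affine
function. Hence integral relations take integral values on these `ψ`. -/
theorem IsTriangulation.exists_int_of_mem_integralFunctions (hT : IsTriangulation X Q T)
    {ψ : LatticePoints X Q → ℝ} (hψ : ψ ∈ integralFunctions X Q T) (ω : LatticePoints X Q) :
    ∃ n : ℤ, ψ ω = n := by
  obtain ⟨s, hs, hωs⟩ := SimplicialComplex.mem_space_iff.1 (hT.space_eq.ge ω.2.1)
  obtain ⟨t, ht, hst⟩ := hT.exists_facet hs
  obtain ⟨a, ha, hat⟩ := hψ.1 t ht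
  obtain ⟨m, hm⟩ := ha ω ω.2.2
  have h := hat (convexHull_mono (Finset.coe_subset.2 hst) hωs)
  by_cases hω : (ω : E) ∈ T.vertices
  · exact ⟨m, by rw [← hm, ← h, hT.interp_vertex ψ hω]⟩
  · obtain ⟨n, hn⟩ := hψ.2 ω hω
    exact ⟨n + m, by push_cast; linarith⟩

theorem IsAffineRelation.functional_mem_latticeL (hT : IsTriangulation X Q T)
    {u : LatticePoints X Q → ℝ} (hu : IsAffineRelation u) (hint : ∀ ω, ∃ n : ℤ, u ω = n) :
    hu.functional ∈ latticeL X Q T := by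
  intro ψ hψ
  choose m hm using hT.exists_int_of_mem_integralFunctions hψ
  choose n hn using hint
  exact ⟨∑ ω, n ω * m ω, by rw [hu.functional_mkQ]; push_cast; simp_rw [hm, hn]⟩

theorem IsAffineRelation.functional_mem_dualCone (hQ : Convex ℝ Q) (hT : IsTriangulation X Q T)
    {u : LatticePoints X Q → ℝ} (hu : IsAffineRelation u) {s : Finset E} (hs : s ∈ T.faces)
    (hus : ∀ ω : LatticePoints X Q, (ω : E) ∉ s → 0 ≤ u ω) :
    hu.functional ∈ dualCone (secondaryCone X Q T) := by
  rintro _ hξ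
  obtain ⟨ψ, hψ, rfl⟩ := PointedCone.mem_map.1 hξ
  change 0 ≤ hu.functional ((affSubspace X Q).mkQ ψ)
  rw [hu.functional_mkQ]
  exact hT.sum_mul_nonneg hQ hψ hs hu hus

theorem IsAffineRelation.functional_neg {u : LatticePoints X Q → ℝ} (hu : IsAffineRelation u) :
    hu.neg.functional = -hu.functional := by
  ext φ
  simpa using (hu.neg.functional_mkQ φ).trans (by simp [← hu.functional_mkQ φ])

theorem IsAffineRelation.functional_smul {u : LatticePoints X Q → ℝ} (hu : IsAffineRelation u)
    (r : ℝ) : (hu.smul r).functional = r • hu.functional := by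
  refine LinearMap.ext fun ξ => ?_
  obtain ⟨φ, rfl⟩ := (affSubspace X Q).mkQ_surjective ξ
  rw [LinearMap.smul_apply, functional_mkQ, functional_mkQ, smul_eq_mul, Finset.mul_sum]
  exact Finset.sum_congr rfl fun ω _ => by simp [mul_assoc]

/-- An integral affine relation whose negative part is supported on a simplex of `T₁` and whose
positive part is supported on a simplex of `T₂` is a unit of the monoid of the wall. -/
theorem IsAffineRelation.functional_mem_unitsTau (hQ : Convex ℝ Q) (hT₁ : IsTriangulation X Q T₁)
    (hT₂ : IsTriangulation X Q T₂) {u : LatticePoints X Q → ℝ} (hu : IsAffineRelation u)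
    (hint : ∀ ω, ∃ n : ℤ, u ω = n) {s t : Finset E} (hs : s ∈ T₁.faces) (ht : t ∈ T₂.faces)
    (hus : ∀ ω : LatticePoints X Q, (ω : E) ∉ s → 0 ≤ u ω)
    (hut : ∀ ω : LatticePoints X Q, (ω : E) ∉ t → u ω ≤ 0) :
    hu.functional ∈ unitsTau X Q T₁ T₂ := by
  have h₁ := hu.functional_mem_dualCone hQ hT₁ hs hus
  have h₂ := hu.neg.functional_mem_dualCone hQ hT₂ ht fun ω hω => neg_nonneg.2 (hut ω hω)
  rw [hu.functional_neg] at h₂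
  have h₃ : hu.functional ∈ latticeTau X Q T₁ T₂ :=
    (le_sup_left : _ ≤ latticeTau X Q T₁ T₂)
      (AddSubgroup.subset_closure ⟨h₁, hu.functional_mem_latticeL hT₁ hint⟩)
  exact ⟨⟨(le_sup_left : dualCone (secondaryCone X Q T₁) ≤ _) h₁, h₃⟩,
    ⟨(le_sup_right : dualCone (secondaryCone X Q T₂) ≤ _) h₂, (latticeTau X Q T₁ T₂).neg_mem h₃⟩⟩

theorem exists_common_denominator {α : Type*} [Fintype α] (q : α → ℚ) :
    ∃ n : ℕ, 0 < n ∧ ∀ i, ∃ m : ℤ, (n : ℚ) * q i = m := by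
  classical
  refine ⟨∏ i, (q i).den, Finset.prod_pos fun i _ => (q i).den_pos, fun i => ?_⟩
  obtain ⟨k, hk⟩ := Finset.dvd_prod_of_mem (fun i => (q i).den) (Finset.mem_univ i)
  refine ⟨k * (q i).num, ?_⟩
  rw [hk]
  push_cast
  rw [mul_right_comm, mul_comm ((q i).den : ℚ), Rat.mul_den_eq_num]
  ring

theorem IsAffineRelation.functional_mem_span_rat (hQ : Convex ℝ Q)
    (hT₁ : IsTriangulation X Q T₁) (hT₂ : IsTriangulation X Q T₂)
    {u : LatticePoints X Q → ℝ} (hu : IsAffineRelation u)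
    (hrat : ∀ ω, ∃ q : ℚ, u ω = q) {s t : Finset E} (hs : s ∈ T₁.faces) (ht : t ∈ T₂.faces)
    (hus : ∀ ω : LatticePoints X Q, (ω : E) ∉ s → 0 ≤ u ω)
    (hut : ∀ ω : LatticePoints X Q, (ω : E) ∉ t → u ω ≤ 0) :
    hu.functional ∈ Submodule.span ℚ (unitsTau X Q T₁ T₂ : Set (LSpace X Q)) := by
  choose q hq using hrat
  obtain ⟨n, hn, hint⟩ := exists_common_denominator q
  have hmem := (hu.smul n).functional_mem_unitsTau hQ hT₁ hT₂ (fun ω => by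
      obtain ⟨m, hm⟩ := hint ω
      exact ⟨m, by rw [Pi.smul_apply, hq ω, smul_eq_mul]; exact_mod_cast hm⟩) hs ht
    (fun ω hω => mul_nonneg n.cast_nonneg (hus ω hω))
    (fun ω hω => mul_nonpos_of_nonneg_of_nonpos n.cast_nonneg (hut ω hω))
  rw [hu.functional_smul] at hmem
  have e : hu.functional = (n : ℚ)⁻¹ • ((n : ℝ) • hu.functional) := by
    rw [Nat.cast_smul_eq_nsmul ℝ, ← Nat.cast_smul_eq_nsmul ℚ, smul_smul,
      inv_mul_cancel₀ (Nat.cast_ne_zero.2 hn.ne'), one_smul]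
  rw [e]
  exact Submodule.smul_mem _ _ (Submodule.subset_span hmem)

end units

end SecondaryFan

end

noncomputable section

namespace SecondaryFan

open Geometry

/-! ### Relations expressed through the universal function -/

section universal

variable {E : Type*} [AddCommGroup E] [Module ℝ E] {X : Submodule ℤ E} {Q : Set E}
  {ι : Type*} [Fintype ι]

theorem Psi_mkQ (σ : AffineBasis ι ℝ E) (hσ : ∀ i, σ i ∈ Q ∧ σ i ∈ X) (ω : LatticePoints X Q)
    (ψ : LatticePoints X Q → ℝ) :
    Psi σ hσ ω ((affSubspace X Q).mkQ ψ) = ψ ω - affineExtension σ hσ ψ ω :=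
  rfl

/-- The correction `L_σ(ψ)` is affine, so the relation annihilates it, whatever `σ` is. -/
theorem IsAffineRelation.functional_eq_sum_Psi [Fintype (LatticePoints X Q)]
    {u : LatticePoints X Q → ℝ}
    (hu : IsAffineRelation u) (σ : AffineBasis ι ℝ E) (hσ : ∀ i, σ i ∈ Q ∧ σ i ∈ X) :
    hu.functional = ∑ ω, u ω • Psi σ hσ ω := by
  refine LinearMap.ext fun ξ => ?_
  obtain ⟨ψ, rfl⟩ := (affSubspace X Q).mkQ_surjective ξ
  rw [hu.functional_mkQ, LinearMap.sum_apply]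
  simp_rw [LinearMap.smul_apply, Psi_mkQ, smul_eq_mul, mul_sub, Finset.sum_sub_distrib,
    hu.sum_mul_affine, sub_zero]

end universal

/-! ### Rational coordinates and rational approximation -/

section rationality

variable {E : Type*} [NormedAddCommGroup E] [NormedSpace ℝ E] [FiniteDimensional ℝ E]
  {X : Submodule ℤ E} [DiscreteTopology X] {Q : Set E}

theorem finite_latticePoints (hQ : IsLatticePolytope X Q) : Finite (LatticePoints X Q) := by
  obtain ⟨s, -, rfl⟩ := hQ
  have : DiscreteTopology X.toAddSubgroup := inferInstanceAs (DiscreteTopology X)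
  have h := Metric.finite_isBounded_inter_isClosed
    (DiscreteTopology.isDiscrete (s := (X.toAddSubgroup : Set E)))
    (isBounded_convexHull.2 s.finite_toSet.isBounded) inferInstance
  exact h.to_subtype

theorem exists_int_coordinates (X : Submodule ℤ E) [DiscreteTopology X] [IsZLattice ℝ X] :
    ∃ (κ : Type) (_ : Fintype κ) (b : Module.Basis κ ℝ E),
      ∀ x ∈ X, ∀ j, ∃ n : ℤ, b.repr x j = n := by
  have : Module.Finite ℤ X := ZLattice.module_finite ℝ X
  have : Module.Free ℤ X := ZLattice.module_free ℝ X
  let c := (Module.Free.chooseBasis ℤ X).reindex (Fintype.equivFin _)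
  exact ⟨_, inferInstance, c.ofZLatticeBasis ℝ X,
    fun x hx j => ⟨c.repr ⟨x, hx⟩ j, c.ofZLatticeBasis_repr_apply ℝ X ⟨x, hx⟩ j⟩⟩

theorem map_mul_int (p : ℝ →ₗ[ℚ] ℝ) (r : ℝ) (n : ℤ) : p (r * n) = p r * n := by
  rw [mul_comm, ← zsmul_eq_mul, map_zsmul, zsmul_eq_mul, mul_comm]

theorem map_rat (p : ℝ →ₗ[ℚ] ℝ) (q : ℚ) : p q = q * p 1 := by
  have := p.map_smul q 1
  rwa [Rat.smul_def, Rat.smul_def, mul_one] at this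

/-- Lattice points have integral coordinates in `b`, and a `ℚ`-linear `p` commutes with integer
multiples. Thus such maps may be applied to the coefficients of a relation. -/
theorem repr_sum_map {E : Type*} [AddCommGroup E] [Module ℝ E] {X : Submodule ℤ E} {Q : Set E}
    [Fintype (LatticePoints X Q)] {κ : Type*} {b : Module.Basis κ ℝ E}
    (hb : ∀ x ∈ X, ∀ j, ∃ n : ℤ, b.repr x j = n) (p : ℝ →ₗ[ℚ] ℝ)
    (u : LatticePoints X Q → ℝ) (j : κ) :
    b.repr (∑ ω, p (u ω) • (ω : E)) j = p (b.repr (∑ ω, u ω • (ω : E)) j) := by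
  simp only [map_sum, map_smul, Finsupp.coe_finsetSum, Finset.sum_apply, Finsupp.smul_apply,
    smul_eq_mul]
  refine Finset.sum_congr rfl fun ω _ => ?_
  obtain ⟨n, hn⟩ := hb ω ω.2.2 j
  rw [hn, map_mul_int]

variable [Fintype (LatticePoints X Q)]

theorem IsAffineRelation.map [IsZLattice ℝ X] {u : LatticePoints X Q → ℝ}
    (hu : IsAffineRelation u) (p : ℝ →ₗ[ℚ] ℝ) : IsAffineRelation fun ω => p (u ω) := by
  obtain ⟨κ, _, b, hb⟩ := exists_int_coordinates X
  refine ⟨by rw [← map_sum, hu.1, map_zero], b.repr.injective (Finsupp.ext fun j => ?_)⟩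
  rw [repr_sum_map hb, hu.2]
  simp

/-- The barycentric coordinates of a rational point with respect to lattice points are rational. -/
theorem exists_rat_of_isRationalPoint [IsZLattice ℝ X] {s : Finset E}
    (hs : AffineIndependent ℝ ((↑) : s → E)) {w : LatticePoints X Q → ℝ}
    (hws : ∀ ω, w ω ≠ 0 → (ω : E) ∈ s) (h1 : ∑ ω, w ω = 1) {x : E}
    (hwx : ∑ ω, w ω • (ω : E) = x) (hx : IsRationalPoint X x) (ω : LatticePoints X Q) :
    ∃ q : ℚ, w ω = q := by
  subst hwx
  -- `p` is a `ℚ`-linear projection of `ℝ` onto `ℚ`. It fixes `1` and the rational coordinates of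
  -- `x`, so `p ∘ w` represents `x` on the same simplex, and affine independence gives `w = p ∘ w`.
  obtain ⟨g, hg⟩ := (Algebra.linearMap ℚ ℝ).exists_leftInverse_of_injective
    (LinearMap.ker_eq_bot.2 (algebraMap ℚ ℝ).injective)
  let p : ℝ →ₗ[ℚ] ℝ := (Algebra.linearMap ℚ ℝ).comp g
  have hp1 : p 1 = 1 := by
    have : g 1 = 1 := by simpa using LinearMap.congr_fun hg 1
    simp [p, this]
  obtain ⟨κ, _, b, hb⟩ := exists_int_coordinates X
  obtain ⟨n, hn, hnx⟩ := hx
  have hrel : IsAffineRelation (w - fun ω => p (w ω)) := by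
    refine IsAffineRelation.sub (by rw [← map_sum, h1, hp1])
      (b.repr.injective (Finsupp.ext fun j => ?_))
    rw [repr_sum_map hb]
    obtain ⟨m, hm⟩ := hb _ hnx j
    have hq : b.repr (∑ ω, w ω • (ω : E)) j = ((m / n : ℚ) : ℝ) := by
      rw [map_nsmul, Finsupp.smul_apply, nsmul_eq_mul] at hm
      push_cast
      rw [eq_div_iff (Nat.cast_ne_zero.2 hn.ne'), mul_comm, hm]
    rw [hq, map_rat, hp1, mul_one]
  have h0 := congrFun (hrel.eq_zero hs fun ω hω => hws ω fun h => hω (by simp [h])) ω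
  exact ⟨g (w ω), sub_eq_zero.1 h0⟩

/-- Every real affine relation between lattice points is a limit of rational ones with the same
signs, so that a linear functional that vanishes on these vanishes on it. -/
theorem IsAffineRelation.exists_rat_approx [IsZLattice ℝ X] {u : LatticePoints X Q → ℝ}
    (hu : IsAffineRelation u) {c : LatticePoints X Q → ℝ} (hc : ∑ ω, u ω * c ω ≠ 0) :
    ∃ v : LatticePoints X Q → ℝ, IsAffineRelation v ∧ (∀ ω, ∃ q : ℚ, v ω = q) ∧
      (∀ ω, 0 ≤ u ω → 0 ≤ v ω) ∧ (∀ ω, u ω ≤ 0 → v ω ≤ 0) ∧ ∑ ω, v ω * c ω ≠ 0 := by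
  classical
  -- Expand the coefficients of `u` in a `ℚ`-basis `r` of their span and replace `r` by arbitrary
  -- reals `y`. Then `U y` is the image of `u` under a `ℚ`-linear map, hence still a relation; it is
  -- rational for rational `y`, and `y = r` recovers `u`.
  let V := Submodule.span ℚ (Set.range u)
  have : FiniteDimensional ℚ V := FiniteDimensional.span_of_finite ℚ (Set.finite_range u)
  let r := Module.finBasis ℚ V
  have huV : ∀ ω, u ω ∈ V := fun ω => Submodule.subset_span ⟨ω, rfl⟩
  let a : LatticePoints X Q → Fin (Module.finrank ℚ V) → ℚ := fun ω => r.repr ⟨u ω, huV ω⟩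
  let U : (Fin (Module.finrank ℚ V) → ℝ) → LatticePoints X Q → ℝ := fun y ω => ∑ k, a ω k * y k
  have hU : ∀ y, ∃ p : ℝ →ₗ[ℚ] ℝ, ∀ ω, p (u ω) = U y ω := by
    intro y
    obtain ⟨p, hp⟩ := LinearMap.exists_extend (r.constr ℚ y)
    refine ⟨p, fun ω => ?_⟩
    have := LinearMap.congr_fun hp ⟨u ω, huV ω⟩
    rw [LinearMap.comp_apply, Submodule.subtype_apply] at this
    rw [this, Module.Basis.constr_apply_fintype]
    exact Finset.sum_congr rfl fun k _ => by rw [Rat.smul_def]; rfl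
  have hUr : U (fun k => r k) = u := by
    funext ω
    have := congrArg (Subtype.val) (r.sum_repr ⟨u ω, huV ω⟩)
    rw [Submodule.coe_sum] at this
    simpa [U, a, Rat.smul_def] using this
  have hcont : ∀ ω, Continuous fun y => U y ω := fun ω => by
    dsimp only [U]
    fun_prop
  -- Strict signs and nonvanishing are open conditions, so a rational `y` meets them. Zero
  -- coefficients stay zero by linearity (`hz`).
  let O : Set (Fin (Module.finrank ℚ V) → ℝ) :=
    {y | ∑ ω, U y ω * c ω ≠ 0} ∩ ⋂ ω, {y | 0 < u ω → 0 < U y ω} ∩ {y | u ω < 0 → U y ω < 0}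
  have hO : IsOpen O := by
    refine IsOpen.inter (isOpen_ne_fun (by fun_prop) continuous_const)
      (isOpen_iInter_of_finite fun ω => IsOpen.inter ?_ ?_)
    · by_cases h : 0 < u ω
      · simpa [h] using isOpen_lt continuous_const (hcont ω)
      · simp [h]
    · by_cases h : u ω < 0
      · simpa [h] using isOpen_lt (hcont ω) continuous_const
      · simp [h]
  have hne : O.Nonempty := ⟨fun k => r k, by simpa [hUr] using hc, by simp [hUr]⟩
  obtain ⟨y, hy0, hy⟩ := (DenseRange.piMap fun _ : Fin (Module.finrank ℚ V) =>
    (Rat.denseRange_cast : DenseRange ((↑) : ℚ → ℝ))).exists_mem_open hO hne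
  rw [Set.mem_iInter] at hy
  obtain ⟨p, hp⟩ := hU (Pi.map (fun _ => ((↑) : ℚ → ℝ)) y)
  have hz : ∀ ω, u ω = 0 → U (Pi.map (fun _ => ((↑) : ℚ → ℝ)) y) ω = 0 := fun ω h => by
    rw [← hp, h, map_zero]
  refine ⟨U (Pi.map (fun _ => ((↑) : ℚ → ℝ)) y), ?_, fun ω => ⟨∑ k, a ω k * y k, ?_⟩,
    fun ω h => ?_, fun ω h => ?_, hy0⟩
  · have := hu.map p
    simpa only [hp] using this
  · push_cast
    rfl
  · rcases h.eq_or_lt with h | h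
    · exact (hz ω h.symm).ge
    · exact ((hy ω).1 h).le
  · rcases h.eq_or_lt with h | h
    · exact (hz ω h).le
    · exact ((hy ω).2 h).le

/-- If `l` killed the units but not `u`, it would be nonzero on a rational relation with compatible
signs, which lies in the `ℚ`-span of the units. -/
theorem IsAffineRelation.functional_mem_span_real [IsZLattice ℝ X] {T₁ T₂ : SimplicialComplex ℝ E}
    (hQ : Convex ℝ Q) (hT₁ : IsTriangulation X Q T₁) (hT₂ : IsTriangulation X Q T₂)
    {ι : Type*} [Fintype ι] (σ : AffineBasis ι ℝ E) (hσ : ∀ i, σ i ∈ Q ∧ σ i ∈ X)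
    {u : LatticePoints X Q → ℝ} (hu : IsAffineRelation u) {s t : Finset E} (hs : s ∈ T₁.faces)
    (ht : t ∈ T₂.faces) (hus : ∀ ω : LatticePoints X Q, (ω : E) ∉ s → 0 ≤ u ω)
    (hut : ∀ ω : LatticePoints X Q, (ω : E) ∉ t → u ω ≤ 0) :
    hu.functional ∈ Submodule.span ℝ (unitsTau X Q T₁ T₂ : Set (LSpace X Q)) := by
  rw [← Subspace.forall_mem_dualAnnihilator_apply_eq_zero_iff]
  intro l hl
  have hsum : ∀ {v : LatticePoints X Q → ℝ} (hv : IsAffineRelation v),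
      l hv.functional = ∑ ω, v ω * l (Psi σ hσ ω) := fun hv => by
    rw [hv.functional_eq_sum_Psi σ hσ, map_sum]
    simp_rw [map_smul, smul_eq_mul]
  by_contra h
  rw [hsum hu] at h
  obtain ⟨v, hv, hrat, hpos, hneg, hv0⟩ := hu.exists_rat_approx h
  refine hv0 ?_
  rw [← hsum hv]
  exact (Submodule.mem_dualAnnihilator l).1 hl _ (Submodule.span_subset_span ℚ ℝ _
    (hv.functional_mem_span_rat hQ hT₁ hT₂ hrat hs ht (fun ω hω => hpos ω (hus ω hω))
      fun ω hω => hneg ω (hut ω hω)))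

end rationality

end SecondaryFan

end

/-! ### The main theorem -/

open SecondaryFan in
theorem mainTheorem6 {E : Type*} [NormedAddCommGroup E] [NormedSpace ℝ E] [FiniteDimensional ℝ E]
    (X : Submodule ℤ E) [DiscreteTopology X] [IsZLattice ℝ X]
    (Q : Set E) (hQ : SecondaryFan.IsLatticePolytope X Q)
    {ι : Type*} [Fintype ι] (σ : AffineBasis ι ℝ E) (hσ : ∀ i, σ i ∈ Q ∧ σ i ∈ X)
    (hreg : SecondaryFan.IsRegularSimplex X σ)
    (T₁ T₂ : Geometry.SimplicialComplex ℝ E)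
    (hT₁ : SecondaryFan.IsTriangulation X Q T₁) (hT₂ : SecondaryFan.IsTriangulation X Q T₂)
    (hc₁ : SecondaryFan.IsCoherent Q T₁) (hc₂ : SecondaryFan.IsCoherent Q T₂)
    (hm₁ : SecondaryFan.IsMaximalCone X Q (SecondaryFan.secondaryCone X Q T₁))
    (hm₂ : SecondaryFan.IsMaximalCone X Q (SecondaryFan.secondaryCone X Q T₂))
    (τ : PointedCone ℝ (SecondaryFan.LStar X Q))
    (hτ : τ = SecondaryFan.secondaryCone X Q T₁ ⊓ SecondaryFan.secondaryCone X Q T₂) :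
    τ.IsFaceOf (SecondaryFan.secondaryCone X Q T₁) ∧
    τ.IsFaceOf (SecondaryFan.secondaryCone X Q T₂) ∧
    SecondaryFan.dualCone τ =
      SecondaryFan.dualCone (SecondaryFan.secondaryCone X Q T₁) ⊔
        SecondaryFan.dualCone (SecondaryFan.secondaryCone X Q T₂) ∧
    (∀ x ∈ Q, SecondaryFan.IsRationalPoint X x →
      SecondaryFan.wallDifference σ hσ T₁ T₂ x ∈
        Submodule.span ℚ (SecondaryFan.unitsTau X Q T₁ T₂ : Set (SecondaryFan.LSpace X Q))) ∧
    (∀ x ∈ Q,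
      SecondaryFan.wallDifference σ hσ T₁ T₂ x ∈
        Submodule.span ℝ (SecondaryFan.unitsTau X Q T₁ T₂ : Set (SecondaryFan.LSpace X Q))) := by
  have := SecondaryFan.finite_latticePoints hQ
  have := Fintype.ofFinite (SecondaryFan.LatticePoints X Q)
  have hconv : Convex ℝ Q := by
    obtain ⟨s, -, rfl⟩ := hQ
    exact convex_convexHull ℝ _
  subst hτ
  have key : ∀ x ∈ Q, ∃ u : LatticePoints X Q → ℝ, ∃ hu : IsAffineRelation u,
      wallDifference σ hσ T₁ T₂ x = -hu.functional ∧
      (∃ s ∈ T₁.faces, ∀ ω : LatticePoints X Q, (ω : E) ∉ s → 0 ≤ u ω) ∧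
      (∃ t ∈ T₂.faces, ∀ ω : LatticePoints X Q, (ω : E) ∉ t → u ω ≤ 0) ∧
      (IsRationalPoint X x → ∀ ω, ∃ q : ℚ, u ω = q) := by
    intro x hx
    obtain ⟨⟨s, hs, hws⟩, hw0, hw1, hwx⟩ := isBarycentric_iff.1 (hT₁.isBarycentric_baryCoords hx)
    obtain ⟨⟨t, ht, hvt⟩, hv0, hv1, hvx⟩ := isBarycentric_iff.1 (hT₂.isBarycentric_baryCoords hx)
    -- Off `s` only the nonnegative `T₂`-coordinates remain, off `t` only the negated
    -- `T₁`-coordinates. This order of subtraction fits the sign conventions of the unit lemmas and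
    -- causes the minus sign.
    refine ⟨⇑(baryCoords X Q T₂ x) - ⇑(baryCoords X Q T₁ x),
      IsAffineRelation.sub (hv1.trans hw1.symm) (hvx.trans hwx.symm), ?_,
      ⟨s, hs, fun ω hω => ?_⟩, ⟨t, ht, fun ω hω => ?_⟩, fun hrat ω => ?_⟩
    · rw [IsAffineRelation.functional_eq_sum_Psi _ σ hσ, wallDifference,
        interp_eq_sum_baryCoords, interp_eq_sum_baryCoords]
      rw [← Finset.sum_sub_distrib, ← Finset.sum_neg_distrib]
      refine Finset.sum_congr rfl fun ω _ => LinearMap.ext fun ξ => ?_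
      simp only [Pi.sub_apply, LinearMap.sub_apply, LinearMap.neg_apply, LinearMap.smul_apply,
        smul_eq_mul]
      ring
    · rw [Pi.sub_apply, of_not_not (mt (hws ω) hω), sub_zero]
      exact hv0 ω
    · rw [Pi.sub_apply, of_not_not (mt (hvt ω) hω), zero_sub]
      exact neg_nonpos.2 (hw0 ω)
    · obtain ⟨q, hq⟩ := exists_rat_of_isRationalPoint (T₁.indep hs) hws hw1 hwx hrat ω
      obtain ⟨r, hr⟩ := exists_rat_of_isRationalPoint (T₂.indep ht) hvt hv1 hvx hrat ω
      exact ⟨r - q, by rw [Pi.sub_apply, hq, hr]; push_cast; rfl⟩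
  refine ⟨isFaceOf_secondaryCone hconv hT₁ hT₂, ?_, dualCone_inf hconv hT₁ hT₂,
    fun x hx hrat => ?_, fun x hx => ?_⟩
  · rw [inf_comm]
    exact isFaceOf_secondaryCone hconv hT₂ hT₁
  · obtain ⟨u, hu, e, ⟨s, hs, hus⟩, ⟨t, ht, hut⟩, hq⟩ := key x hx
    rw [e]
    exact neg_mem (hu.functional_mem_span_rat hconv hT₁ hT₂ (hq hrat) hs ht hus hut)
  · obtain ⟨u, hu, e, ⟨s, hs, hus⟩, ⟨t, ht, hut⟩, -⟩ := key x hx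
    rw [e]
    exact neg_mem (hu.functional_mem_span_real hconv hT₁ hT₂ σ hσ hs ht hus hut)
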